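/- For real $x>0$ let $L^*(x)=\lfloor\log_2 x\rfloor+2\bigl(1-2^{\lfloor\log_2 x\rfloor-\log_2 x}\bigr)$. The binary erasure channel (BEC) with erasure probability $\delta\in[0,1)$ has input alphabet $\{0,1\}$ and output alphabet $\{0,\mathrm e,1\}$; each input symbol is, independently of the past, replaced by the erasure symbol $\mathrm e$ with probability $\delta$ and received correctly with probability $1-\delta$. Let $\ell>0$ be real, let $M\ge1$ be an integer, and let $\varepsilon\in[0,1]$. An $(\ell,M,\varepsilon)$-VLF (variable-length full-feedback) code over this channel consists of: 1. common randomness $U$, taking values in a set $\mathcal U$ with $|\mathcal U|\le2$ and known to the encoder and the decoder, and a message $W$, uniformly distributed on $\{1,\dots,M\}$ and independent of $U$; 2. encoders $f_n:\mathcal U\times\{1,\dots,M\}\times\{0,\mathrm e,1\}^{n-1}\to\{0,1\}$, $n\ge1$, generating the channel inputs $X_n=f_n(U,W,Y_1,\dots,Y_{n-1})$; given $(U,W,Y_1,\dots,Y_{n-1})$, the output $Y_n$ has the conditional law of the BEC output for the input $X_n$; 3. decoders $g_n:\mathcal U\times\{0,\mathrm e,1\}^n\to\{1,\dots,M\}$,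 $n\ge0$; 4. a stopping time $\tau$ of the filtration $\mathcal G_n=\sigma(U,Y_1,\dots,Y_n)$, $n\ge0$, with values in $\{0,1,2,\dots\}\cup\{\infty\}$ and $\mathbb E[\tau]\le\ell$ (so that $\tau<\infty$ almost surely); such that the final estimate $\hat W=g_\tau(U,Y_1,\dots,Y_\tau)$ satisfies $\mathbb P[\hat W\ne W]\le\varepsilon$. **Theorem.** Every $(\ell,M,\varepsilon)$-VLF code over a BEC with erasure probability $\delta\in[0,1)$ satisfies $$\ell\;\ge\;\frac{(1-\varepsilon)\,L^*\bigl(M(1-\varepsilon)\bigr)}{1-\delta},$$ where the right-hand side is read as $0$ when $\varepsilon=1$. -/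

import Mathlib

open MeasureTheory ProbabilityTheory

/-- `L*(x) = ⌊log₂ x⌋ + 2 (1 - 2 ^ (⌊log₂ x⌋ - log₂ x))`. -/
noncomputable def lStar (x : ℝ) : ℝ :=
  (⌊Real.logb 2 x⌋ : ℝ) + 2 * (1 - (2 : ℝ) ^ ((⌊Real.logb 2 x⌋ : ℝ) - Real.logb 2 x))

/-- The output alphabet `{0, e, 1}` of the binary erasure channel; the input alphabet is `Bool`. -/
inductive BECOutput : Type
  | bit (b : Bool)
  | erasure

instance : MeasurableSpace BECOutput := ⊤

instance : DiscreteMeasurableSpace BECOutput := ⟨fun _ => trivial⟩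

/-- Transition probabilities of the binary erasure channel with erasure probability `δ`:
`becLaw δ x y` is the probability of the output `y` when the input is `x`. -/
noncomputable def becLaw (δ : ℝ) (x : Bool) : BECOutput → ℝ
  | .bit b => if b = x then 1 - δ else 0
  | .erasure => δ

/-- The first `n` channel outputs `(Y_1, …, Y_n)`, where `Y k` is the output at time `k + 1`. -/
def firstOutputs {Ω : Type*} (Y : ℕ → Ω → BECOutput) (n : ℕ) (ω : Ω) : Fin n → BECOutput :=
  fun k => Y k ω

theorem measurable_firstOutputs {Ω : Type*} [MeasurableSpace Ω] {Y : ℕ → Ω → BECOutput}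
    (hY : ∀ k, Measurable (Y k)) (n : ℕ) : Measurable (firstOutputs Y n) :=
  measurable_pi_lambda _ fun k => hY k

/-- The filtration `𝒢_n = σ(U, Y_1, …, Y_n)` generated by the common randomness and the
channel outputs. -/
def receiverFiltration {Ω 𝒰 : Type*} [mΩ : MeasurableSpace Ω] [MeasurableSpace 𝒰]
    {U : Ω → 𝒰} {Y : ℕ → Ω → BECOutput} (hU : Measurable U) (hY : ∀ k, Measurable (Y k)) :
    Filtration ℕ mΩ where
  seq n := MeasurableSpace.comap (fun ω => (U ω, firstOutputs Y n ω)) inferInstance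
  mono' := by
    intro m n hmn
    have hr : Measurable
        (fun p : 𝒰 × (Fin n → BECOutput) => (p.1, fun k : Fin m => p.2 (Fin.castLE hmn k))) :=
      measurable_fst.prodMk (measurable_pi_lambda _ fun k =>
        (measurable_pi_apply (Fin.castLE hmn k)).comp measurable_snd)
    rintro s ⟨t, ht, rfl⟩
    exact ⟨_, hr ht, rfl⟩
  le' n := (hU.prodMk (measurable_firstOutputs hY n)).comap_le

/-- A variable-length full-feedback scheme for `M` messages operating over the binary erasure
channel with erasure probability `δ`, on the probability space `(Ω, P)`, with common randomness
taking values in `𝒰`. Time is indexed from `0` here: `encoder n` and `output n` are the encoder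
and the channel output at time `n + 1`. -/
structure VLFScheme {Ω : Type*} [MeasurableSpace Ω] (P : Measure Ω) (𝒰 : Type*) [Fintype 𝒰]
    [MeasurableSpace 𝒰] (δ : ℝ) (M : ℕ) where
  /-- The common randomness, known to the encoder and to the decoder. -/
  commonRand : Ω → 𝒰
  measurable_commonRand : Measurable commonRand
  card_le_two : Fintype.card 𝒰 ≤ 2
  /-- The message, uniformly distributed and independent of the common randomness. -/
  message : Ω → Fin M
  measurable_message : Measurable message
  message_uniform : ∀ w, P.real {ω | message ω = w} = 1 / (M : ℝ)
  indep : IndepFun commonRand message P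
  /-- Full feedback: the channel input depends on all past channel outputs. -/
  encoder : (n : ℕ) → 𝒰 → Fin M → (Fin n → BECOutput) → Bool
  /-- The decoders `g_n`. -/
  decoder : (n : ℕ) → 𝒰 → (Fin n → BECOutput) → Fin M
  /-- The channel outputs. -/
  output : ℕ → Ω → BECOutput
  measurable_output : ∀ k, Measurable (output k)
  /-- Given the common randomness, the message and the past outputs, the next output is drawn
  from the binary erasure channel, applied to the current channel input. -/
  channel : ∀ (n : ℕ) (u : 𝒰) (w : Fin M) (y : Fin n → BECOutput) (b : BECOutput),
    P.real {ω | commonRand ω = u ∧ message ω = w ∧ firstOutputs output n ω = y ∧ output n ω = b} =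
      P.real {ω | commonRand ω = u ∧ message ω = w ∧ firstOutputs output n ω = y} *
        becLaw δ (encoder n u w y) b
  /-- The stopping time at which the final decision is taken. -/
  stopTime : Ω → ℕ∞
  isStoppingTime : IsStoppingTime
    (receiverFiltration measurable_commonRand measurable_output) stopTime

namespace VLFScheme

variable {Ω : Type*} [MeasurableSpace Ω] {P : Measure Ω} {𝒰 : Type*} [Fintype 𝒰]
  [MeasurableSpace 𝒰] {δ : ℝ} {M : ℕ}

/-- The final estimate `g_τ(U, Y_1, …, Y_τ)` of the message. (The value on the event `τ = ∞` is
irrelevant: that event has probability zero as soon as the mean of `τ` is finite.) -/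
def finalEstimate (S : VLFScheme P 𝒰 δ M) (ω : Ω) : Fin M :=
  S.decoder (S.stopTime ω).toNat (S.commonRand ω) (firstOutputs S.output (S.stopTime ω).toNat ω)

/-- The scheme is an `(ℓ, M, ε)`-VLF code: its mean stopping time is at most `ℓ`, and its error
probability is at most `ε`. -/
structure IsCode (S : VLFScheme P 𝒰 δ M) (ℓ ε : ℝ) : Prop where
  blocklength_pos : 0 < ℓ
  error_mem : ε ∈ Set.Icc (0 : ℝ) 1
  mean_stopTime_le : ∫⁻ ω, (S.stopTime ω : ENNReal) ∂P ≤ ENNReal.ofReal ℓ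
  error_le : P.real {ω | S.finalEstimate ω ≠ S.message ω} ≤ ε

end VLFScheme

/-! Let `N` be the number of unerased outputs up to the stopping time and `C` the event of correct
decoding. For every integer `k ≥ 0`, pointwise where `τ < ∞`, `(k + 2) 1_C ≤ N + 2 ^ (k + 1) * 2 ^
(-N) * 1_C`; this carries the proof once both terms on the right are bounded in mean.

`E[N] ≤ (1 - δ) E[τ]`, because `{n < τ}` is decided before the output at index `n` is drawn
(`lintegral_numReceived_le`). `E[2 ^ (-N) 1_C] ≤ 1 / M` by a change of measure
(`lintegral_tsum_correctWeight_le`): the factor `2 ^ (-N)` turns the bound on transcript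
probabilities into a product of uniform-input output laws, the decoder leaves one message per output
sequence, and Kraft's inequality bounds the sum over stopping sequences.

Taking `k = ⌊log₂ (M (1 - ε))⌋` gives exactly the claimed bound; if this floor is negative, the
bound is trivial. -/

open scoped ENNReal

/-! ### The channel law and its uniform-input output law -/

/-- A channel output is either a bit or the erasure symbol. -/
def BECOutput.equivOption : Option Bool ≃ BECOutput where
  toFun o := o.elim .erasure .bit
  invFun y := match y with
    | .bit b => some b
    | .erasure => none
  left_inv := by rintro (_ | _) <;> rfl
  right_inv := by rintro (_ | _) <;> rfl

instance : Fintype BECOutput := Fintype.ofEquiv (Option Bool) BECOutput.equivOption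

theorem BECOutput.sum_eq {α : Type*} [AddCommMonoid α] (f : BECOutput → α) :
    ∑ y, f y = f .erasure + (f (.bit true) + f (.bit false)) := by
  rw [← BECOutput.equivOption.sum_comp, Fintype.sum_option, Fintype.sum_bool]
  rfl

/-- The largest transition probability to a given output. -/
noncomputable def becMaxLaw (δ : ℝ) : BECOutput → ℝ≥0∞
  | .bit _ => ENNReal.ofReal (1 - δ)
  | .erasure => ENNReal.ofReal δ

theorem ofReal_becLaw_le (δ : ℝ) (x : Bool) (y : BECOutput) :
    ENNReal.ofReal (becLaw δ x y) ≤ becMaxLaw δ y := by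
  cases y with
  | erasure => exact le_rfl
  | bit b =>
    simp only [becLaw, becMaxLaw]
    split_ifs <;> simp

/-- Each received bit counts with weight `1 / 2`. -/
noncomputable def bitWeight : BECOutput → ℝ≥0∞
  | .bit _ => 2⁻¹
  | .erasure => 1

/-- The output law of the binary erasure channel for a uniformly distributed input. -/
noncomputable def becUniformMeasure (δ : ℝ) : Measure BECOutput :=
  Measure.sum fun y => (bitWeight y * becMaxLaw δ y) • Measure.dirac y

theorem becUniformMeasure_singleton (δ : ℝ) (y : BECOutput) :
    becUniformMeasure δ {y} = bitWeight y * becMaxLaw δ y := by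
  classical
  rw [becUniformMeasure, Measure.sum_apply _ (MeasurableSet.singleton y), tsum_fintype,
    Finset.sum_eq_single y]
  · simp
  · intro b _ hb
    simp [hb]
  · simp

/-- The maximal transition probabilities add up to `2 - δ`; halving those of the two bits brings the
total to `1`. -/
theorem isProbabilityMeasure_becUniformMeasure {δ : ℝ} (h0 : 0 ≤ δ) (h1 : δ < 1) :
    IsProbabilityMeasure (becUniformMeasure δ) := by
  constructor
  rw [becUniformMeasure, Measure.sum_apply _ MeasurableSet.univ, tsum_fintype, BECOutput.sum_eq]
  simp only [bitWeight, becMaxLaw, Measure.smul_apply, measure_univ, smul_eq_mul, mul_one, one_mul]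
  rw [← add_mul, ENNReal.inv_two_add_inv_two, one_mul, ← ENNReal.ofReal_add h0 (by linarith)]
  simp

/-! ### Kraft's inequality -/

theorem infinitePi_cylinder {α : Type*} [MeasurableSpace α] [MeasurableSingletonClass α]
    (μ : Measure α) [IsProbabilityMeasure μ] (n : ℕ) (y : Fin n → α) :
    Measure.infinitePi (fun _ : ℕ => μ) {z | (fun i : Fin n => z i) = y} = ∏ i, μ {y i} := by
  have h := Measure.infinitePi_pi (fun _ : ℕ => μ) (s := Finset.range n)
    (t := fun i => if h : i < n then {y ⟨i, h⟩} else Set.univ)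
    (by intro i _; split_ifs; exacts [MeasurableSet.singleton _, MeasurableSet.univ])
  rw [Finset.prod_range] at h
  simp only [Fin.is_lt, dif_pos, Fin.eta] at h
  rw [← h]
  congr 1
  ext z
  simp only [Set.mem_ofPred_eq, Set.mem_pi, Finset.coe_range, Set.mem_Iio]
  constructor
  · rintro h i hi
    simp [hi, ← h]
  · intro h
    funext i
    simpa using h i i.2

/-- Kraft's inequality for a family of stopping sets no two of which contain initial segments of
the same sequence. -/
theorem tsum_sum_prod_le_one {α : Type*} [Fintype α] [MeasurableSpace α]
    [MeasurableSingletonClass α] (μ : Measure α) [IsProbabilityMeasure μ]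
    (A : (n : ℕ) → Set (Fin n → α))
    (hA : ∀ (z : ℕ → α) (m n : ℕ), (fun i : Fin m => z i) ∈ A m → (fun i : Fin n => z i) ∈ A n →
      m = n) :
    ∑' n, ∑ y, (A n).indicator (fun y => ∏ i, μ {y i}) y ≤ 1 := by
  classical
  have hm : ∀ n, Measurable fun (z : ℕ → α) (i : Fin n) => z i := fun n =>
    measurable_pi_lambda _ fun i => measurable_pi_apply _
  -- Draw an infinite i.i.d. sequence: each inner sum is the probability of stopping at length `n`,
  -- and these events are disjoint by `hA`.
  have key : ∀ n, ∑ y, (A n).indicator (fun y => ∏ i, μ {y i}) y =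
      Measure.infinitePi (fun _ : ℕ => μ) {z | (fun i : Fin n => z i) ∈ A n} := by
    intro n
    have h := sum_measure_preimage_singleton (μ := Measure.infinitePi (fun _ : ℕ => μ))
      (Finset.univ.filter (· ∈ A n)) (f := fun (z : ℕ → α) (i : Fin n) => z i)
      (fun y _ => hm n (MeasurableSet.singleton y))
    rw [Finset.sum_filter] at h
    rw [show {z : ℕ → α | (fun i : Fin n => z i) ∈ A n} =
      (fun (z : ℕ → α) (i : Fin n) => z i) ⁻¹' ↑(Finset.univ.filter (· ∈ A n)) by ext; simp, ← h]
    refine Finset.sum_congr rfl fun y _ => ?_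
    rw [Set.indicator_apply, ← infinitePi_cylinder]
    rfl
  simp_rw [key]
  rw [← measure_iUnion]
  · exact prob_le_one
  · intro m n hmn
    exact Set.disjoint_left.2 fun z h1 h2 => hmn (hA z m n h1 h2)
  · exact fun n => hm n (Set.toFinite _).measurableSet

/-! ### Events decided by the receiver, and transcript probabilities -/

theorem receiverFiltration_mem_iff {Ω 𝒰 : Type*} [MeasurableSpace Ω] [MeasurableSpace 𝒰]
    {U : Ω → 𝒰} {Y : ℕ → Ω → BECOutput} {hU : Measurable U} {hY : ∀ k, Measurable (Y k)} {n : ℕ}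
    {s : Set Ω} (hs : MeasurableSet[receiverFiltration hU hY n] s) {ω ω' : Ω} (h1 : U ω = U ω')
    (h2 : firstOutputs Y n ω = firstOutputs Y n ω') : ω ∈ s ↔ ω' ∈ s := by
  obtain ⟨t, -, rfl⟩ := hs
  simp only [Set.mem_preimage, h1, h2]

theorem firstOutputs_succ_eq_iff {Ω : Type*} (Y : ℕ → Ω → BECOutput) (n : ℕ) (ω : Ω)
    (y : Fin (n + 1) → BECOutput) : firstOutputs Y (n + 1) ω = y ↔
      firstOutputs Y n ω = (fun i => y i.castSucc) ∧ Y n ω = y (Fin.last n) := by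
  constructor
  · rintro rfl
    exact ⟨rfl, rfl⟩
  · rintro ⟨h1, h2⟩
    funext i
    refine Fin.lastCases h2 (fun j => congrFun h1 j) i

namespace VLFScheme

variable {Ω : Type*} [MeasurableSpace Ω] {P : Measure Ω} {𝒰 : Type*} [Fintype 𝒰]
  [MeasurableSpace 𝒰] {δ : ℝ} {M : ℕ}

/-- The common randomness, the message and the first `n` outputs. -/
def transcript (S : VLFScheme P 𝒰 δ M) (n : ℕ) (ω : Ω) : 𝒰 × Fin M × (Fin n → BECOutput) :=
  (S.commonRand ω, S.message ω, firstOutputs S.output n ω)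

theorem measurable_transcript (S : VLFScheme P 𝒰 δ M) (n : ℕ) : Measurable (S.transcript n) :=
  S.measurable_commonRand.prodMk
    (S.measurable_message.prodMk (measurable_firstOutputs S.measurable_output n))

theorem measure_transcript_zero [IsProbabilityMeasure P] [DiscreteMeasurableSpace 𝒰]
    (S : VLFScheme P 𝒰 δ M) (hM : 0 < M) (u : 𝒰) (w : Fin M) (y : Fin 0 → BECOutput) :
    P (S.transcript 0 ⁻¹' {(u, w, y)}) = P (S.commonRand ⁻¹' {u}) * (M : ℝ≥0∞)⁻¹ := by
  have h := S.indep.measure_inter_preimage_eq_mul {u} {w} (MeasurableSet.singleton u)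
    (MeasurableSet.singleton w)
  have hw : P (S.message ⁻¹' {w}) = (M : ℝ≥0∞)⁻¹ := by
    have h := S.message_uniform w
    rw [measureReal_def] at h
    change P {ω | S.message ω = w} = _
    rw [← ENNReal.ofReal_toReal (measure_ne_top P {ω | S.message ω = w}), h, one_div,
      ENNReal.ofReal_inv_of_pos (by exact_mod_cast hM), ENNReal.ofReal_natCast]
  rw [← hw, ← h]
  congr 1
  ext ω
  simp [transcript, Subsingleton.elim (firstOutputs S.output 0 ω) y]

theorem measure_transcript_inter_output [IsProbabilityMeasure P] (S : VLFScheme P 𝒰 δ M) (n : ℕ)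
    (z : 𝒰 × Fin M × (Fin n → BECOutput)) (b : BECOutput) :
    P (S.transcript n ⁻¹' {z} ∩ {ω | S.output n ω = b}) =
      P (S.transcript n ⁻¹' {z}) * ENNReal.ofReal (becLaw δ (S.encoder n z.1 z.2.1 z.2.2) b) := by
  obtain ⟨u, w, y⟩ := z
  have h := S.channel n u w y b
  have h1 : {ω | S.commonRand ω = u ∧ S.message ω = w ∧ firstOutputs S.output n ω = y ∧
      S.output n ω = b} = S.transcript n ⁻¹' {(u, w, y)} ∩ {ω | S.output n ω = b} := by
    ext ω
    simp [transcript, and_assoc]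
  have h2 : {ω | S.commonRand ω = u ∧ S.message ω = w ∧ firstOutputs S.output n ω = y} =
      S.transcript n ⁻¹' {(u, w, y)} := by
    ext ω
    simp [transcript]
  rw [h1, h2] at h
  rw [← ofReal_measureReal (measure_ne_top _ _), h, ENNReal.ofReal_mul measureReal_nonneg,
    ofReal_measureReal (measure_ne_top _ _)]

/-- Bounding every transition by its maximum over inputs removes the feedback encoder, so the bound
depends on the message no longer. -/
theorem measure_transcript_le [IsProbabilityMeasure P] [DiscreteMeasurableSpace 𝒰]
    (S : VLFScheme P 𝒰 δ M) (hM : 0 < M) (n : ℕ) (u : 𝒰) (w : Fin M) (y : Fin n → BECOutput) :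
    P (S.transcript n ⁻¹' {(u, w, y)}) ≤
      P (S.commonRand ⁻¹' {u}) * (M : ℝ≥0∞)⁻¹ * ∏ i, becMaxLaw δ (y i) := by
  induction n with
  | zero => simp [S.measure_transcript_zero hM]
  | succ n ih =>
    have h : S.transcript (n + 1) ⁻¹' {(u, w, y)} =
        S.transcript n ⁻¹' {(u, w, fun i => y i.castSucc)} ∩
          {ω | S.output n ω = y (Fin.last n)} := by
      ext ω
      simp [transcript, firstOutputs_succ_eq_iff, and_assoc]
    rw [h, measure_transcript_inter_output, Fin.prod_univ_castSucc, ← mul_assoc]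
    exact mul_le_mul' (ih _) (ofReal_becLaw_le _ _ _)

/-- Each transcript value determines membership in `s` and fixes the next input; only that input bit
can then arrive unerased, with probability `1 - δ`. -/
theorem measure_inter_output_ne_erasure_le [IsProbabilityMeasure P] [DiscreteMeasurableSpace 𝒰]
    (S : VLFScheme P 𝒰 δ M) (n : ℕ) (s : Set Ω)
    (hs : MeasurableSet[receiverFiltration S.measurable_commonRand S.measurable_output n] s) :
    P (s ∩ {ω | S.output n ω ≠ .erasure}) ≤ ENNReal.ofReal (1 - δ) * P s := by
  classical
  have hsum : ∀ t : Set Ω, MeasurableSet t →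
      P t = ∑ z, P (S.transcript n ⁻¹' {z} ∩ t) := by
    intro t ht
    have h := sum_measure_preimage_singleton (μ := P.restrict t) Finset.univ
      (f := S.transcript n) (fun z _ => S.measurable_transcript n (MeasurableSet.singleton z))
    simp only [Finset.coe_univ, Set.preimage_univ, Measure.restrict_apply_univ] at h
    rw [← h]
    exact Finset.sum_congr rfl fun z _ =>
      Measure.restrict_apply (S.measurable_transcript n (MeasurableSet.singleton z))
  have hs' : MeasurableSet s := (receiverFiltration _ _).le n s hs
  have ho : MeasurableSet {ω | S.output n ω ≠ .erasure} :=
    S.measurable_output n (t := {b | b ≠ BECOutput.erasure}) MeasurableSet.of_discrete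
  rw [hsum _ (hs'.inter ho), hsum s hs', Finset.mul_sum]
  refine Finset.sum_le_sum fun z _ => ?_
  by_cases hz : ∃ ω ∈ s, S.transcript n ω = z
  · obtain ⟨ω, hω, rfl⟩ := hz
    have hsub : S.transcript n ⁻¹' {S.transcript n ω} ⊆ s := by
      intro ω' hω'
      simp only [Set.mem_preimage, Set.mem_singleton_iff, transcript, Prod.mk.injEq] at hω'
      exact (receiverFiltration_mem_iff hs hω'.1 hω'.2.2).2 hω
    rw [← Set.inter_assoc, Set.inter_eq_left.2 hsub]
    have hne : {ω | S.output n ω ≠ .erasure} =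
        {ω | S.output n ω = .bit true} ∪ {ω | S.output n ω = .bit false} := by
      ext ω
      simp only [Set.mem_ofPred_eq, Set.mem_union]
      rcases S.output n ω with (_ | _) | _ <;> simp
    rw [hne, Set.inter_union_distrib_left]
    refine (measure_union_le _ _).trans ?_
    rw [measure_transcript_inter_output, measure_transcript_inter_output, ← mul_add, mul_comm]
    refine mul_le_mul' ?_ le_rfl
    cases S.encoder n (S.transcript n ω).1 (S.transcript n ω).2.1 (S.transcript n ω).2.2 <;>
      simp [becLaw]
  · have : S.transcript n ⁻¹' {z} ∩ (s ∩ {ω | S.output n ω ≠ .erasure}) = ∅ := by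
      ext ω
      simp only [Set.mem_inter_iff, Set.mem_preimage, Set.mem_singleton_iff, Set.mem_empty_iff_false,
        iff_false]
      exact fun h => hz ⟨ω, h.2.1, h.1⟩
    simp [this]

theorem measurableSet_lt_stopTime (S : VLFScheme P 𝒰 δ M) (n : ℕ) :
    MeasurableSet[receiverFiltration S.measurable_commonRand S.measurable_output n]
      {ω | (n : ℕ∞) < S.stopTime ω} := by
  have h := (S.isStoppingTime n).compl
  convert h using 1
  ext ω
  simp only [Set.mem_ofPred_eq, Set.mem_compl_iff]
  exact not_le.symm

theorem measurableSet_stopTime_eq (S : VLFScheme P 𝒰 δ M) (n : ℕ) :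
    MeasurableSet[receiverFiltration S.measurable_commonRand S.measurable_output n]
      {ω | S.stopTime ω = (n : ℕ∞)} :=
  S.isStoppingTime.measurableSet_eq n

end VLFScheme

/-! ### The pointwise inequality -/

theorem ENat.tsum_indicator_lt (a : ℕ∞) :
    ∑' n : ℕ, {n : ℕ | (n : ℕ∞) < a}.indicator (fun _ => (1 : ℝ≥0∞)) n = a := by
  rw [← tsum_subtype, ENNReal.tsum_const, mul_one]
  congr 1
  induction a using ENat.recTopCoe with
  | top => simp
  | coe a =>
    simp only [Nat.cast_lt]
    simp

/-- With `m = k + 1 - j` this is `m + 1 ≤ 2 ^ m`; for `j ≥ k + 2` the first term suffices. Equality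
holds at `j = k` and `j = k + 1`. -/
theorem natCast_add_two_le (k j : ℕ) :
    (k + 2 : ℝ≥0∞) ≤ j + 2 ^ (k + 1) * 2⁻¹ ^ j := by
  rcases le_or_gt j (k + 1) with h | h
  · obtain ⟨m, hm⟩ := Nat.exists_eq_add_of_le h
    have h2 : (2 : ℝ≥0∞) ^ (k + 1) * 2⁻¹ ^ j = ((2 ^ m : ℕ) : ℝ≥0∞) := by
      rw [hm, add_comm j m, pow_add, mul_assoc, ← mul_pow,
        ENNReal.mul_inv_cancel two_ne_zero ENNReal.ofNat_ne_top]
      simp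
    rw [h2]
    have := Nat.lt_two_pow_self (n := m)
    exact_mod_cast (by omega : k + 2 ≤ j + 2 ^ m)
  · refine le_trans ?_ le_self_add
    exact_mod_cast h

theorem natCast_add_two_le_sum_add_prod_bitWeight (k n : ℕ) (y : ℕ → BECOutput) :
    (k + 2 : ℝ≥0∞) ≤ (∑ i ∈ Finset.range n, {b | b ≠ BECOutput.erasure}.indicator 1 (y i)) +
      2 ^ (k + 1) * ∏ i : Fin n, bitWeight (y i) := by
  classical
  refine (natCast_add_two_le k ((Finset.range n).filter (y · ≠ .erasure)).card).trans (le_of_eq ?_)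
  congr 1
  · rw [Finset.card_filter]
    push_cast
    exact Finset.sum_congr rfl fun i _ => by simp [Set.indicator_apply]
  · congr 1
    rw [← Finset.prod_range fun i => bitWeight (y i), ← Finset.prod_const, Finset.prod_filter]
    refine Finset.prod_congr rfl fun i _ => ?_
    cases y i <;> simp [bitWeight]

/-! ### Expectations of received bits and of the weight of correct transcripts -/

namespace VLFScheme

variable {Ω : Type*} [MeasurableSpace Ω] {P : Measure Ω} {𝒰 : Type*} [Fintype 𝒰]
  [MeasurableSpace 𝒰] {δ : ℝ} {M : ℕ}

/-- The number of unerased outputs up to the stopping time. -/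
noncomputable def numReceived (S : VLFScheme P 𝒰 δ M) (ω : Ω) : ℝ≥0∞ :=
  ∑' n : ℕ, ({ω | (n : ℕ∞) < S.stopTime ω} ∩ {ω | S.output n ω ≠ .erasure}).indicator 1 ω

theorem measurableSet_lt_inter (S : VLFScheme P 𝒰 δ M) (n : ℕ) :
    MeasurableSet ({ω | (n : ℕ∞) < S.stopTime ω} ∩ {ω | S.output n ω ≠ .erasure}) :=
  ((receiverFiltration _ _).le n _ (S.measurableSet_lt_stopTime n)).inter
    (S.measurable_output n (t := {b | b ≠ BECOutput.erasure}) MeasurableSet.of_discrete)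

theorem measurable_numReceived (S : VLFScheme P 𝒰 δ M) : Measurable S.numReceived :=
  Measurable.tsum fun n => measurable_one.indicator (S.measurableSet_lt_inter n)

theorem lintegral_numReceived_le [IsProbabilityMeasure P] [DiscreteMeasurableSpace 𝒰]
    (S : VLFScheme P 𝒰 δ M) :
    ∫⁻ ω, S.numReceived ω ∂P ≤ ENNReal.ofReal (1 - δ) * ∫⁻ ω, (S.stopTime ω : ℝ≥0∞) ∂P := by
  have hlt : ∀ n : ℕ, MeasurableSet {ω | (n : ℕ∞) < S.stopTime ω} := fun n =>
    (receiverFiltration _ _).le n _ (S.measurableSet_lt_stopTime n)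
  have hτ : ∫⁻ ω, (S.stopTime ω : ℝ≥0∞) ∂P = ∑' n : ℕ, P {ω | (n : ℕ∞) < S.stopTime ω} := by
    simp_rw [← lintegral_indicator_one (hlt _)]
    rw [← lintegral_tsum fun n => (measurable_one.indicator (hlt n)).aemeasurable]
    refine lintegral_congr fun ω => ?_
    rw [← ENat.tsum_indicator_lt]
    rfl
  rw [hτ, ← ENNReal.tsum_mul_left]
  unfold numReceived
  rw [lintegral_tsum fun n => (measurable_one.indicator (S.measurableSet_lt_inter n)).aemeasurable]
  refine ENNReal.tsum_le_tsum fun n => ?_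
  rw [lintegral_indicator_one (S.measurableSet_lt_inter n)]
  exact S.measure_inter_output_ne_erasure_le n _ (S.measurableSet_lt_stopTime n)

/-- The output sequences of length `n` at which the scheme stops if the common randomness
is `u`. -/
def stopSet (S : VLFScheme P 𝒰 δ M) (n : ℕ) (u : 𝒰) : Set (Fin n → BECOutput) :=
  {y | ∃ ω, S.commonRand ω = u ∧ firstOutputs S.output n ω = y ∧ S.stopTime ω = (n : ℕ∞)}

theorem firstOutputs_mem_stopSet_iff (S : VLFScheme P 𝒰 δ M) (n : ℕ) (ω : Ω) :
    firstOutputs S.output n ω ∈ S.stopSet n (S.commonRand ω) ↔ S.stopTime ω = (n : ℕ∞) := by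
  constructor
  · rintro ⟨ω', h1, h2, h3⟩
    exact (receiverFiltration_mem_iff (S.measurableSet_stopTime_eq n) h1 h2).1 h3
  · exact fun h => ⟨ω, rfl, rfl, h⟩

theorem eq_of_mem_stopSet (S : VLFScheme P 𝒰 δ M) (u : 𝒰) (z : ℕ → BECOutput) (m n : ℕ)
    (hm : (fun i : Fin m => z i) ∈ S.stopSet m u) (hn : (fun i : Fin n => z i) ∈ S.stopSet n u) :
    m = n := by
  wlog hmn : m ≤ n generalizing m n
  · exact (this n m hn hm (le_of_not_ge hmn)).symm
  obtain ⟨ω, h1, h2, h3⟩ := hm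
  obtain ⟨ω', h1', h2', h3'⟩ := hn
  have h : firstOutputs S.output m ω' = firstOutputs S.output m ω := by
    rw [h2]
    funext i
    exact congrFun h2' (Fin.castLE hmn i)
  -- The longer path agrees with the shorter one up to time `m`, so it has to stop at `m` too.
  have h4 := (receiverFiltration_mem_iff (S.measurableSet_stopTime_eq m) (h1'.trans h1.symm) h).2 h3
  exact_mod_cast (Eq.symm h4).trans h3'

/-- The weight `2 ^ (-N)`, `N` the number of unerased outputs, of a transcript of length `n` at the
end of which the scheme stops with the correct estimate; other transcripts have weight `0`. -/
noncomputable def correctWeight (S : VLFScheme P 𝒰 δ M) (n : ℕ)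
    (z : 𝒰 × Fin M × (Fin n → BECOutput)) : ℝ≥0∞ :=
  {z : 𝒰 × Fin M × (Fin n → BECOutput) |
    z.2.2 ∈ S.stopSet n z.1 ∧ S.decoder n z.1 z.2.2 = z.2.1}.indicator
      (fun z => ∏ i, bitWeight (z.2.2 i)) z

theorem lintegral_correctWeight_le [IsProbabilityMeasure P] [DiscreteMeasurableSpace 𝒰]
    (S : VLFScheme P 𝒰 δ M) (hM : 0 < M) (n : ℕ) :
    ∫⁻ ω, S.correctWeight n (S.transcript n ω) ∂P ≤
      ∑ u, P (S.commonRand ⁻¹' {u}) * (M : ℝ≥0∞)⁻¹ *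
        ∑ y, (S.stopSet n u).indicator (fun y => ∏ i, becUniformMeasure δ {y i}) y := by
  classical
  rw [← lintegral_map (f := S.correctWeight n) Measurable.of_discrete (S.measurable_transcript n),
    lintegral_fintype, Fintype.sum_prod_type]
  refine Finset.sum_le_sum fun u _ => ?_
  rw [Fintype.sum_prod_type, Finset.sum_comm, Finset.mul_sum]
  refine Finset.sum_le_sum fun y _ => ?_
  -- Only the decoded message has nonzero weight, which is why the factor `1 / M` survives the sum
  -- over messages.
  rw [Finset.sum_eq_single (S.decoder n u y)]
  · rw [Measure.map_apply (S.measurable_transcript n) (MeasurableSet.singleton _)]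
    by_cases hy : y ∈ S.stopSet n u
    · simp only [correctWeight, Set.indicator_apply, Set.mem_ofPred_eq, hy, and_self, if_true,
        becUniformMeasure_singleton, Finset.prod_mul_distrib]
      rw [mul_left_comm]
      exact mul_le_mul' le_rfl (S.measure_transcript_le hM n u _ y)
    · simp [correctWeight, hy]
  · intro w _ hw
    simp [correctWeight, hw.symm]
  · simp

theorem lintegral_tsum_correctWeight_le [IsProbabilityMeasure P] [DiscreteMeasurableSpace 𝒰]
    (S : VLFScheme P 𝒰 δ M) (hM : 0 < M) (h0 : 0 ≤ δ) (h1 : δ < 1) :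
    ∫⁻ ω, ∑' n, S.correctWeight n (S.transcript n ω) ∂P ≤ (M : ℝ≥0∞)⁻¹ := by
  have := isProbabilityMeasure_becUniformMeasure h0 h1
  have hm : ∀ n, AEMeasurable (fun ω => S.correctWeight n (S.transcript n ω)) P := fun n =>
    ((Measurable.of_discrete (f := S.correctWeight n)).comp (S.measurable_transcript n)).aemeasurable
  rw [lintegral_tsum hm]
  refine (ENNReal.tsum_le_tsum fun n => S.lintegral_correctWeight_le hM n).trans ?_
  rw [Summable.tsum_finsetSum fun _ _ => ENNReal.summable]
  have hU : ∑ u, P (S.commonRand ⁻¹' {u}) = 1 := by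
    rw [sum_measure_preimage_singleton Finset.univ
      fun u _ => S.measurable_commonRand (MeasurableSet.singleton u)]
    simp
  calc _ ≤ ∑ u, P (S.commonRand ⁻¹' {u}) * (M : ℝ≥0∞)⁻¹ := by
        refine Finset.sum_le_sum fun u _ => ?_
        rw [ENNReal.tsum_mul_left]
        exact mul_le_of_le_one_right zero_le
          (tsum_sum_prod_le_one _ _ (S.eq_of_mem_stopSet u))
    _ = (M : ℝ≥0∞)⁻¹ := by rw [← Finset.sum_mul, hU, one_mul]

theorem indicator_correct_le (S : VLFScheme P 𝒰 δ M) (k : ℕ) {ω : Ω} (hω : S.stopTime ω ≠ ⊤) :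
    {ω | S.finalEstimate ω = S.message ω}.indicator (fun _ => (k + 2 : ℝ≥0∞)) ω ≤
      S.numReceived ω + 2 ^ (k + 1) * ∑' n, S.correctWeight n (S.transcript n ω) := by
  by_cases hc : ω ∈ {ω | S.finalEstimate ω = S.message ω}
  swap
  · simp [Set.indicator_of_notMem hc]
  rw [Set.indicator_of_mem hc]
  obtain ⟨n, hn⟩ := ENat.ne_top_iff_exists.1 hω
  refine (natCast_add_two_le_sum_add_prod_bitWeight k n fun i => S.output i ω).trans ?_
  refine add_le_add ?_ (mul_le_mul' le_rfl ?_)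
  · refine le_trans (Finset.sum_le_sum fun i hi => ?_) (ENNReal.sum_le_tsum (Finset.range n))
    have hi' : (i : ℕ∞) < S.stopTime ω := by
      rw [← hn]
      exact_mod_cast Finset.mem_range.1 hi
    by_cases he : S.output i ω = .erasure
    · simp [he]
    · rw [Set.indicator_of_mem (show S.output i ω ∈ {b | b ≠ BECOutput.erasure} from he),
        Set.indicator_of_mem (Set.mem_inter (show ω ∈ {ω | (i : ℕ∞) < S.stopTime ω} from hi')
          (show ω ∈ {ω | S.output i ω ≠ .erasure} from he))]
      rfl
  · refine le_trans ?_ (ENNReal.le_tsum n)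
    have hd : S.decoder n (S.commonRand ω) (firstOutputs S.output n ω) = S.message ω := by
      have hτ : (S.stopTime ω).toNat = n := by rw [← hn, ENat.toNat_natCast]
      have hc' : S.finalEstimate ω = S.message ω := hc
      rwa [finalEstimate, hτ] at hc'
    rw [correctWeight, Set.indicator_of_mem]
    · rfl
    · exact ⟨(S.firstOutputs_mem_stopSet_iff n ω).2 hn.symm, hd⟩

theorem measurableSet_correct [DiscreteMeasurableSpace 𝒰] (S : VLFScheme P 𝒰 δ M) :
    MeasurableSet {ω | S.finalEstimate ω = S.message ω} := by
  have hn : ∀ n : ℕ, MeasurableSet {ω | (S.stopTime ω).toNat = n} := by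
    intro n
    -- `toNat` sends `⊤` to `0`, so the case `n = 0` also contains the paths that never stop.
    have h : {ω | (S.stopTime ω).toNat = n} = {ω | S.stopTime ω = (n : ℕ∞)} ∪
        ({_ω | n = 0} ∩ ⋂ m : ℕ, {ω | (m : ℕ∞) < S.stopTime ω}) := by
      ext ω
      simp only [Set.mem_ofPred_eq, Set.mem_union, Set.mem_inter_iff, Set.mem_iInter,
        ← ENat.eq_top_iff_forall_gt]
      cases S.stopTime ω using ENat.recTopCoe <;> simp [eq_comm]
    rw [h]
    exact ((receiverFiltration _ _).le n _ (S.measurableSet_stopTime_eq n)).union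
      ((MeasurableSet.const _).inter (MeasurableSet.iInter fun m =>
        (receiverFiltration _ _).le m _ (S.measurableSet_lt_stopTime m)))
  have h : {ω | S.finalEstimate ω = S.message ω} =
      ⋃ n : ℕ, {ω | (S.stopTime ω).toNat = n} ∩
        S.transcript n ⁻¹' {z | S.decoder n z.1 z.2.2 = z.2.1} := by
    ext ω
    simp [finalEstimate, transcript]
  rw [h]
  exact MeasurableSet.iUnion fun n =>
    (hn n).inter (S.measurable_transcript n MeasurableSet.of_discrete)

theorem add_two_mul_measure_correct_le [IsProbabilityMeasure P] [DiscreteMeasurableSpace 𝒰]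
    (S : VLFScheme P 𝒰 δ M) (hM : 0 < M) (h0 : 0 ≤ δ) (h1 : δ < 1) {ℓ ε : ℝ} (hS : S.IsCode ℓ ε)
    (k : ℕ) :
    (k + 2 : ℝ≥0∞) * P {ω | S.finalEstimate ω = S.message ω} ≤
      ENNReal.ofReal (1 - δ) * ENNReal.ofReal ℓ + 2 ^ (k + 1) * (M : ℝ≥0∞)⁻¹ := by
  have hτm : Measurable fun ω => (S.stopTime ω : ℝ≥0∞) := by
    simp_rw [← ENat.tsum_indicator_lt]
    exact Measurable.tsum fun n => measurable_one.indicator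
      ((receiverFiltration _ _).le n _ (S.measurableSet_lt_stopTime n))
  have hfin : ∀ᵐ ω ∂P, S.stopTime ω ≠ ⊤ := by
    filter_upwards [ae_lt_top hτm (hS.mean_stopTime_le.trans_lt ENNReal.ofReal_lt_top).ne] with ω hω
    intro h
    simp [h] at hω
  rw [← lintegral_indicator_const S.measurableSet_correct]
  refine (lintegral_mono_ae (hfin.mono fun ω hω => S.indicator_correct_le k hω)).trans ?_
  rw [lintegral_add_left S.measurable_numReceived, lintegral_const_mul']
  · exact add_le_add (S.lintegral_numReceived_le.trans (mul_le_mul' le_rfl hS.mean_stopTime_le))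
      (mul_le_mul' le_rfl (S.lintegral_tsum_correctWeight_le hM h0 h1))
  · simp

end VLFScheme

/-! ### From the bounds indexed by `k` to `lStar` -/

theorem mul_lStar_eq {x : ℝ} (hx : 0 < x) :
    x * lStar x = (⌊Real.logb 2 x⌋ + 2 : ℝ) * x - 2 * (2 : ℝ) ^ ⌊Real.logb 2 x⌋ := by
  rw [lStar, Real.rpow_sub two_pos, Real.rpow_logb two_pos (by norm_num) hx, Real.rpow_intCast]
  field_simp
  ring

theorem mainTheorem1 {Ω : Type*} [MeasurableSpace Ω] (P : Measure Ω) [IsProbabilityMeasure P]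
    {𝒰 : Type*} [Fintype 𝒰] [MeasurableSpace 𝒰] [DiscreteMeasurableSpace 𝒰]
    (δ : ℝ) (hδ0 : 0 ≤ δ) (hδ1 : δ < 1) (M : ℕ) (hM : 0 < M) (ℓ ε : ℝ)
    (S : VLFScheme P 𝒰 δ M) (hS : S.IsCode ℓ ε) :
    ℓ ≥ (1 - ε) * lStar (M * (1 - ε)) / (1 - δ) := by
  have hδ : 0 < 1 - δ := by linarith
  have hℓ := hS.blocklength_pos
  have hMr : (0 : ℝ) < M := by exact_mod_cast hM
  rw [ge_iff_le, div_le_iff₀ hδ]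
  rcases hS.error_mem.2.eq_or_lt with rfl | hε
  · simp only [sub_self, zero_mul]
    positivity
  have hx : 0 < M * (1 - ε) := mul_pos hMr (by linarith)
  -- Scaling by `M` produces `x * lStar x` with `x = M (1 - ε)`, which is affine in `x` once the
  -- floor is fixed.
  refine le_of_mul_le_mul_left ?_ hMr
  rw [← mul_assoc, mul_lStar_eq hx]
  have hpos : 0 ≤ M * (ℓ * (1 - δ)) := by positivity
  rcases lt_or_ge ⌊Real.logb 2 (M * (1 - ε))⌋ 0 with hk | hk
  -- For a floor `k ≤ -1`, `(k + 2) x ≤ x < 2 * 2 ^ k`, so the claimed lower bound is negative.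
  · have hle : (2 : ℝ) ^ (⌊Real.logb 2 (M * (1 - ε))⌋ + 1) > M * (1 - ε) := by
      have h := Int.lt_floor_add_one (Real.logb 2 (M * (1 - ε)))
      rw [Real.logb_lt_iff_lt_rpow one_lt_two hx] at h
      exact_mod_cast h
    rw [zpow_add_one₀ two_ne_zero] at hle
    have hk' : (⌊Real.logb 2 (M * (1 - ε))⌋ : ℝ) ≤ -1 := by
      exact_mod_cast (by omega : ⌊Real.logb 2 (M * (1 - ε))⌋ ≤ -1)
    nlinarith
  · obtain ⟨k, hk⟩ := Int.eq_ofNat_of_zero_le hk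
    rw [hk]
    have hP : 1 - ε ≤ P.real {ω | S.finalEstimate ω = S.message ω} := by
      have h2 := probReal_add_probReal_compl (μ := P) S.measurableSet_correct
      have h3 : P.real {ω | S.finalEstimate ω = S.message ω}ᶜ ≤ ε := hS.error_le
      linarith
    have h := ENNReal.toReal_mono (by finiteness)
      (S.add_two_mul_measure_correct_le hM hδ0 hδ1 hS k)
    rw [ENNReal.toReal_add (by finiteness) (by finiteness)] at h
    simp only [ENNReal.toReal_mul, ENNReal.toReal_ofReal hδ.le, ENNReal.toReal_ofReal hℓ.le] at h
    have e1 : ((k : ℝ≥0∞) + 2).toReal = k + 2 := by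
      rw [ENNReal.toReal_add (by finiteness) (by finiteness)]
      simp
    have e2 : ((2 : ℝ≥0∞) ^ (k + 1)).toReal = 2 * 2 ^ k := by
      rw [ENNReal.toReal_pow, ENNReal.toReal_ofNat, pow_succ']
    rw [e1, e2, ENNReal.toReal_inv, ENNReal.toReal_natCast] at h
    have h' : (k + 2 : ℝ) * (1 - ε) ≤ (1 - δ) * ℓ + 2 * 2 ^ k * (M : ℝ)⁻¹ :=
      (mul_le_mul_of_nonneg_left hP (by positivity)).trans h
    have h2 := mul_le_mul_of_nonneg_left h' hMr.le
    rw [mul_add, mul_left_comm (M : ℝ) _ (M : ℝ)⁻¹, mul_inv_cancel₀ hMr.ne'] at h2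
    push_cast
    rw [zpow_natCast]
    linarith
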